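/- Let $m\ge 0$. On the Fock space of $m$ fermionic modes, with occupation basis $|x\rangle$, $x\in\{0,1\}^m$, let $a_i$ be the annihilation operators ($a_i|x\rangle=0$ if $x_i=0$; otherwise $a_i$ empties mode $i$ and multiplies by $(-1)^{\sum_{j<i}x_j}$), and let $\gamma_{2i-1}=a_i+a_i^\dagger$, $\gamma_{2i}=-\mathrm i(a_i-a_i^\dagger)$ be the Majorana operators. For an increasing index sequence $\mu=(\mu_1<\dots<\mu_k)$ in $[2m]$, identified with a subset of $[2m]$, put $\Gamma_\mu=(-\mathrm i)^{\binom k2}\gamma_{\mu_1}\cdots\gamma_{\mu_k}$. For each permutation $p$ of $[2m]$ let $U(p)$ be the unitary, unique up to a phase, with $U(p)\gamma_jU(p)^\dagger=\gamma_{p(j)}$ for all $j$. In the affine-matchgate ensemble $p$ is uniformly random among the $(2m)!$ permutations, and given $p$ the outcome $b\in\{0,1\}^m$ has probability $\operatorname{tr}(\rho\,U(p)^\dagger|b\rangle\langle b|U(p))$. Let $$\mathcal M(\rho)=\mathbb E\left[U(p)^\dagger|b\rangle\langle b|U(p)\right]=\frac1{(2m)!}\sum_{p}\sum_{b}\operatorname{tr}\left(\rho\,U(p)^\dagger|b\rangle\langle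 b|U(p)\right)U(p)^\dagger|b\rangle\langle b|U(p),$$ extended linearly to all operators. For integers $k,k',a$ with $0\le a\le k,k'$ and $k,k'\le m$, $k+k'-a\le m$, let $$\lambda_{m,k}=\frac{\binom mk}{\binom{2m}{2k}},\qquad \lambda_{m,k,k',a}=\frac{\binom{m}{a,\;k-a,\;k'-a,\;m-k-k'+a}}{\binom{2m}{2a,\;2(k-a),\;2(k'-a),\;2(m-k-k'+a)}},$$ and let both be $0$ if one of $k,k',a$ is a half-integer that is not an integer. **Theorem.** 1. For every $\mu\subseteq[2m]$, $\mathcal M(\Gamma_\mu)=\lambda_{m,|\mu|/2}\,\Gamma_\mu$ (in particular $\mathcal M(\Gamma_\mu)=0$ if $|\mu|$ is odd). 2. $\mathcal M$ maps the span of the even-degree $\Gamma_\mu$ bijectively onto itself, and $U(p)^\dagger|b\rangle\langle b|U(p)$ lies in this span for all $p,b$. Hence the estimator $\hat h=\operatorname{tr}\left(H\,\mathcal M^{-1}(U(p)^\dagger|b\rangle\langle b|U(p))\right)$ is well defined for every operator $H$, where $\mathcal M^{-1}$ is the inverse on the even span. 3. If $|\mu|$, $|\mu'|$ and $|\mu\cap\mu'|$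 are even, then $\Gamma_\mu\Gamma_{\mu'}=\varepsilon_{\mu,\mu'}\Gamma_{\mu\triangle\mu'}$ for a sign $\varepsilon_{\mu,\mu'}\in\{1,-1\}$. 4. Let $\rho=\sum_{\tau\subseteq[2m]}g_\tau\Gamma_\tau$ be any state (a positive semidefinite operator of trace $1$) and let $H=\sum_{|\mu|\text{ even}}h_\mu\Gamma_\mu$ be any Hermitian operator of this form. Then $$\mathbb E[\hat h^2]=2^m\sum_{\substack{|\mu|,\,|\mu'|\text{ even}\\ |\mu\cap\mu'|\text{ even}}}\kappa_{m,\mu,\mu'}\,h_\mu h_{\mu'}\,g_{\mu\mu'},\qquad \kappa_{m,\mu,\mu'}=\frac{\lambda_{m,\frac{|\mu|}2,\frac{|\mu'|}2,\frac{|\mu\cap\mu'|}2}}{\lambda_{m,\frac{|\mu|}2}\,\lambda_{m,\frac{|\mu'|}2}},$$ where $g_{\mu\mu'}=\varepsilon_{\mu,\mu'}\,g_{\mu\triangle\mu'}$ is the coefficient of $\rho$ that belongs to $\Gamma_{\mu\mu'}=\Gamma_\mu\Gamma_{\mu'}$. -/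

import Mathlib

namespace MajoranaShadow

open Matrix

/-- Occupation bit strings of `m` fermionic modes; they index the computational basis. -/
abbrev Bits (m : ℕ) : Type := Fin m → Bool

/-- Operators on the `m`-mode Fock space, as matrices in the computational basis. -/
abbrev Op (m : ℕ) : Type := Matrix (Bits m) (Bits m) ℂ

/-- The sign `(-1) ^ (∑ j < i, x j)`. -/
def jwSign {m : ℕ} (i : Fin m) (x : Bits m) : ℂ :=
  ∏ j ∈ Finset.Iio i, if x j = true then (-1 : ℂ) else 1

/-- The annihilation operator: it kills `|x⟩` when mode `i` is empty, and otherwise empties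
mode `i` and multiplies by `(-1) ^ (∑ j < i, x j)`. -/
def annihilation {m : ℕ} (i : Fin m) : Op m :=
  Matrix.of fun y x =>
    if x i = true ∧ y = Function.update x i false then jwSign i x else 0

/-- The mode to which a single-mode Majorana operator belongs (indices start at `0`). -/
def mode {m : ℕ} (j : Fin (2 * m)) : Fin m := ⟨j.val / 2, by omega⟩

/-- The `2 m` single-mode Majorana operators. With indices starting at `0`, the operators number
`2 i` and `2 i + 1` are `a i + (a i)†` and `-i (a i - (a i)†)`. -/
noncomputable def majorana {m : ℕ} (j : Fin (2 * m)) : Op m :=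
  if j.val % 2 = 0 then annihilation (mode j) + (annihilation (mode j))ᴴ
  else (-Complex.I) • (annihilation (mode j) - (annihilation (mode j))ᴴ)

/-- The degree-`k` Majorana operator `Γ_μ = (-i) ^ (k choose 2) γ_{μ₁} ⋯ γ_{μ_k}` of an increasing
index sequence `μ₁ < ⋯ < μ_k`, which is given by the finite set of its entries. -/
noncomputable def Gam {m : ℕ} (μ : Finset (Fin (2 * m))) : Op m :=
  (-Complex.I) ^ (μ.card.choose 2) • ((μ.sort (· ≤ ·)).map majorana).prod

/-! ### Unitaries that permute the Majorana operators -/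

/-- `x` with the occupation of mode `i` changed. -/
def flipBit {m : ℕ} (i : Fin m) (x : Bits m) : Bits m := Function.update x i (!x i)

/-- The only nonzero entry of column `x` of `majorana j`. -/
noncomputable def majPhase {m : ℕ} (j : Fin (2 * m)) (x : Bits m) : ℂ :=
  jwSign (mode j) x *
    (if j.val % 2 = 0 then 1 else if x (mode j) = true then -Complex.I else Complex.I)

theorem flipBit_flipBit {m : ℕ} (i : Fin m) (x : Bits m) : flipBit i (flipBit i x) = x := by
  simp [flipBit]

theorem flipBit_comm {m : ℕ} (i j : Fin m) (x : Bits m) :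
    flipBit i (flipBit j x) = flipBit j (flipBit i x) := by
  by_cases h : i = j
  · subst h; rfl
  · unfold flipBit
    rw [Function.update_of_ne h, Function.update_of_ne (Ne.symm h), Function.update_comm h]

theorem star_jwSign {m : ℕ} (i : Fin m) (x : Bits m) : star (jwSign i x) = jwSign i x := by
  unfold jwSign
  rw [star_prod]
  refine Finset.prod_congr rfl fun j _ => ?_
  split_ifs <;> simp

theorem jwSign_mul_self {m : ℕ} (i : Fin m) (x : Bits m) : jwSign i x * jwSign i x = 1 := by
  unfold jwSign
  rw [← Finset.prod_mul_distrib]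
  refine Finset.prod_eq_one fun j _ => ?_
  split_ifs <;> simp

theorem jwSign_flipBit_of_le {m : ℕ} {i k : Fin m} (h : i ≤ k) (x : Bits m) :
    jwSign i (flipBit k x) = jwSign i x := by
  unfold jwSign
  refine Finset.prod_congr rfl fun j hj => ?_
  have : j ≠ k := ne_of_lt (lt_of_lt_of_le (Finset.mem_Iio.1 hj) h)
  simp [flipBit, Function.update_of_ne this]

theorem jwSign_flipBit_of_lt {m : ℕ} {i k : Fin m} (h : k < i) (x : Bits m) :
    jwSign i (flipBit k x) = -jwSign i x := by
  unfold jwSign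
  have hk : k ∈ Finset.Iio i := Finset.mem_Iio.2 h
  rw [← Finset.mul_prod_erase _ _ hk, ← Finset.mul_prod_erase _ _ hk, ← neg_mul]
  congr 1
  · cases hx : x k <;> simp [flipBit, hx]
  · refine Finset.prod_congr rfl fun j hj => ?_
    simp [flipBit, Function.update_of_ne (Finset.ne_of_mem_erase hj)]

theorem annihilation_conjTranspose_apply {m : ℕ} (i : Fin m) (y x : Bits m) :
    (annihilation i)ᴴ y x =
      if x i = false ∧ y = Function.update x i true then jwSign i x else 0 := by
  rw [Matrix.conjTranspose_apply, annihilation, Matrix.of_apply]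
  by_cases h : x i = false ∧ y = Function.update x i true
  · obtain ⟨h1, rfl⟩ := h
    have hf : Function.update x i true = flipBit i x := by simp [flipBit, h1]
    have h2 : x = Function.update (Function.update x i true) i false := by
      rw [Function.update_idem, ← h1, Function.update_eq_self]
    have e1 : Function.update x i true i = true ∧
        x = Function.update (Function.update x i true) i false := ⟨by simp, h2⟩
    rw [if_pos e1, if_pos ⟨h1, rfl⟩, star_jwSign, hf, jwSign_flipBit_of_le le_rfl]
  · rw [if_neg h, if_neg, star_zero]
    rintro ⟨h1, rfl⟩
    refine h ⟨by simp, ?_⟩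
    rw [Function.update_idem, ← h1, Function.update_eq_self]

theorem majorana_apply {m : ℕ} (j : Fin (2 * m)) (y x : Bits m) :
    majorana j y x = if y = flipBit (mode j) x then majPhase j x else 0 := by
  have hA : annihilation (mode j) y x =
      if x (mode j) = true ∧ y = Function.update x (mode j) false
      then jwSign (mode j) x else 0 := rfl
  have hC := annihilation_conjTranspose_apply (mode j) y x
  unfold majorana majPhase
  by_cases h1 : j.val % 2 = 0
  · rw [if_pos h1, if_pos h1, Matrix.add_apply, hA, hC]
    cases hx : x (mode j) <;> simp [flipBit, hx]
  · rw [if_neg h1, if_neg h1, Matrix.smul_apply, Matrix.sub_apply, hA, hC]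
    cases hx : x (mode j) <;> simp [flipBit, hx, mul_comm]
    split_ifs <;> simp

theorem majorana_mul_apply {m : ℕ} (j k : Fin (2 * m)) (y x : Bits m) :
    (majorana j * majorana k) y x =
      if y = flipBit (mode j) (flipBit (mode k) x)
      then majPhase j (flipBit (mode k) x) * majPhase k x else 0 := by
  simp [Matrix.mul_apply, majorana_apply]

theorem majorana_conjTranspose {m : ℕ} (j : Fin (2 * m)) : (majorana j)ᴴ = majorana j := by
  unfold majorana
  split_ifs
  · simp [add_comm]
  · rw [Matrix.conjTranspose_smul]
    simp [smul_sub]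
    abel

theorem majorana_mul_self {m : ℕ} (j : Fin (2 * m)) : majorana j * majorana j = 1 := by
  ext y x
  rw [majorana_mul_apply, flipBit_flipBit, Matrix.one_apply]
  congr 1
  unfold majPhase
  rw [jwSign_flipBit_of_le le_rfl, mul_mul_mul_comm, jwSign_mul_self]
  cases hx : x (mode j) <;> split_ifs <;> simp_all [flipBit]

theorem majorana_anticomm {m : ℕ} {j k : Fin (2 * m)} (h : j ≠ k) :
    majorana j * majorana k = -(majorana k * majorana j) := by
  have key : ∀ {j k : Fin (2 * m)}, j ≠ k → mode j ≤ mode k → ∀ x,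
      majPhase j (flipBit (mode k) x) * majPhase k x =
        -(majPhase k (flipBit (mode j) x) * majPhase j x) := by
    intro j k h hle x
    unfold majPhase
    rcases hle.lt_or_eq with hlt | heq
    · rw [jwSign_flipBit_of_le hle, jwSign_flipBit_of_lt hlt]
      have h1 : flipBit (mode k) x (mode j) = x (mode j) := by
        simp [flipBit, Function.update_of_ne hlt.ne]
      have h2 : flipBit (mode j) x (mode k) = x (mode k) := by
        simp [flipBit, Function.update_of_ne hlt.ne']
      rw [h1, h2]
      ring
    · have hv : j.val / 2 = k.val / 2 := congrArg Fin.val heq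
      have hne : j.val ≠ k.val := fun e => h (Fin.ext e)
      rw [heq, jwSign_flipBit_of_le le_rfl]
      cases hx : x (mode k) <;>
        rcases Nat.mod_two_eq_zero_or_one j.val with h1 | h1 <;>
        rcases Nat.mod_two_eq_zero_or_one k.val with h2 | h2 <;>
        first
          | (exfalso; omega)
          | (simp [flipBit, hx, h1, h2]; ring)
  ext y x
  rw [Matrix.neg_apply, majorana_mul_apply, majorana_mul_apply, flipBit_comm (mode k)]
  split_ifs
  · rcases le_total (mode j) (mode k) with hle | hle
    · exact key h hle x
    · rw [key h.symm hle x, neg_neg]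
  · simp

/-- The parity operator, with eigenvalue `(-1) ^ (∑ i, x i)` on `|x⟩`. -/
noncomputable def parityOp (m : ℕ) : Op m :=
  Matrix.diagonal fun x => ∏ i, if x i = true then (-1 : ℂ) else 1

theorem parityOp_conjTranspose (m : ℕ) : (parityOp m)ᴴ = parityOp m := by
  unfold parityOp
  rw [Matrix.diagonal_conjTranspose]
  congr 1
  ext x
  rw [Pi.star_apply, star_prod]
  refine Finset.prod_congr rfl fun j _ => ?_
  split_ifs <;> simp

theorem parityOp_mul_self (m : ℕ) : parityOp m * parityOp m = 1 := by
  unfold parityOp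
  rw [Matrix.diagonal_mul_diagonal, ← Matrix.diagonal_one]
  congr 1
  ext x
  rw [← Finset.prod_mul_distrib]
  refine Finset.prod_eq_one fun j _ => ?_
  split_ifs <;> simp

theorem parityOp_mul_majorana {m : ℕ} (j : Fin (2 * m)) :
    parityOp m * majorana j = -(majorana j * parityOp m) := by
  ext y x
  unfold parityOp
  rw [Matrix.neg_apply, Matrix.diagonal_mul, Matrix.mul_diagonal, majorana_apply]
  split_ifs with h
  · subst h
    have hk := Finset.mem_univ (mode j)
    rw [← Finset.mul_prod_erase _ _ hk, ← Finset.mul_prod_erase _ (fun i => if x i = true then (-1 : ℂ) else 1) hk]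
    have : ∏ i ∈ Finset.univ.erase (mode j), (if flipBit (mode j) x i = true then (-1 : ℂ) else 1)
        = ∏ i ∈ Finset.univ.erase (mode j), (if x i = true then (-1 : ℂ) else 1) := by
      refine Finset.prod_congr rfl fun i hi => ?_
      simp [flipBit, Function.update_of_ne (Finset.ne_of_mem_erase hi)]
    rw [this]
    cases hx : x (mode j) <;> simp [flipBit, hx] <;> ring
  · simp

theorem sub_mul_sub_self {R : Type*} [Ring R] {a b : R} (ha : a * a = 1) (hb : b * b = 1)
    (hab : a * b = -(b * a)) : (a - b) * (a - b) = 2 := by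
  rw [sub_mul, mul_sub, mul_sub, ha, hb, hab, ← one_add_one_eq_two]
  abel

theorem sub_mul_mul_sub {R : Type*} [Ring R] {a b : R} (ha : a * a = 1) (hb : b * b = 1)
    (hab : a * b = -(b * a)) : (a - b) * a * (a - b) = -(2 * b) := by
  rw [sub_mul, ha, mul_sub, sub_mul, sub_mul, one_mul, one_mul, mul_assoc b a a, ha,
    mul_assoc b a b, hab, mul_neg, ← mul_assoc b b a, hb, two_mul]
  simp only [mul_one, one_mul]
  abel

theorem exists_swap_unitary {m : ℕ} {i j : Fin (2 * m)} (h : i ≠ j) :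
    ∃ U ∈ Matrix.unitaryGroup (Bits m) ℂ,
      ∀ k, U * majorana k * Uᴴ = majorana (Equiv.swap i j k) := by
  obtain ⟨c, hcs, hc⟩ : ∃ c : ℂ, star c = c ∧ c * c * 2 = 1 := by
    refine ⟨((Real.sqrt 2)⁻¹ : ℝ), Complex.conj_ofReal _, ?_⟩
    rw [← Complex.ofReal_mul, ← mul_inv, Real.mul_self_sqrt (by norm_num)]
    norm_num
  have two_smul' : ∀ X : Op m, (c * c) • (2 * X) = X := fun X => by
    rw [two_mul, ← two_smul ℂ X, smul_smul, hc, one_smul]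
  have hi := majorana_mul_self i
  have hj := majorana_mul_self j
  have hij := majorana_anticomm h
  set D : Op m := majorana i - majorana j with hD
  have hDs : Dᴴ = D := by
    rw [hD, Matrix.conjTranspose_sub, majorana_conjTranspose, majorana_conjTranspose]
  have hDD : D * D = 2 := sub_mul_sub_self hi hj hij
  set P : Op m := parityOp m with hP
  have hPP : P * P = 1 := parityOp_mul_self m
  have hW : (P * (c • D))ᴴ = (c • D) * P := by
    rw [Matrix.conjTranspose_mul, Matrix.conjTranspose_smul, hcs, hDs, hP, parityOp_conjTranspose]
  have hconj : ∀ k, D * majorana k * D = -(2 * majorana (Equiv.swap i j k)) := by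
    intro k
    by_cases hki : k = i
    · subst hki
      rw [Equiv.swap_apply_left]
      exact sub_mul_mul_sub hi hj hij
    by_cases hkj : k = j
    · subst hkj
      rw [Equiv.swap_apply_right]
      have := sub_mul_mul_sub hj hi (majorana_anticomm h.symm)
      rw [← this, hD, ← neg_sub (majorana k) (majorana i)]
      simp only [neg_mul, mul_neg, neg_neg]
    · rw [Equiv.swap_apply_of_ne_of_ne hki hkj, hD, sub_mul,
        majorana_anticomm (Ne.symm hki), majorana_anticomm (Ne.symm hkj), ← neg_sub_neg,
        neg_neg, neg_neg, ← mul_sub, mul_assoc, ← neg_sub (majorana i), neg_mul, ← hD, hDD,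
        mul_neg, mul_two, two_mul]
  refine ⟨P * (c • D), ?_, fun k => ?_⟩
  · rw [Matrix.mem_unitaryGroup_iff, Matrix.star_eq_conjTranspose, hW]
    have : (c • D) * (c • D) = 1 := by
      rw [smul_mul_smul_comm, hDD, ← mul_one (2 : Op m), two_smul']
    rw [mul_assoc, ← mul_assoc (c • D), this, one_mul, hPP]
  · rw [hW]
    have : (c • D) * majorana k * (c • D) = -majorana (Equiv.swap i j k) := by
      rw [smul_mul_assoc, smul_mul_smul_comm, hconj, smul_neg, two_smul']
    calc P * (c • D) * majorana k * (c • D * P)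
        = P * ((c • D) * majorana k * (c • D)) * P := by simp only [mul_assoc]
      _ = majorana (Equiv.swap i j k) := by
        rw [this, mul_neg, parityOp_mul_majorana, neg_neg, mul_assoc, hPP, mul_one]

/-- Every permutation of the `2 m` Majorana operators is implemented by a unitary
(which is unique up to a phase). -/
theorem exists_permUnitary {m : ℕ} (p : Equiv.Perm (Fin (2 * m))) :
    ∃ U ∈ Matrix.unitaryGroup (Bits m) ℂ,
      ∀ k, U * majorana k * Uᴴ = majorana (p k) := by
  induction p using Equiv.Perm.swap_induction_on with
  | one => exact ⟨1, one_mem _, by simp⟩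
  | swap_mul f i j h ih =>
    obtain ⟨U, hU, hU'⟩ := ih
    obtain ⟨V, hV, hV'⟩ := exists_swap_unitary h
    refine ⟨V * U, mul_mem hV hU, fun k => ?_⟩
    rw [Equiv.Perm.mul_apply, ← hV', ← hU', Matrix.conjTranspose_mul]
    simp only [mul_assoc]

/-- The unitary `U(p)` of the affine-matchgate ensemble that corresponds to the permutation `p`
of the Majorana operators: `U(p) γ_k U(p)† = γ_{p k}` for all `k`. This determines `U(p)` up to a
phase, which has no effect below, where only conjugation by `U(p)` is used. -/
noncomputable def permUnitary {m : ℕ} (p : Equiv.Perm (Fin (2 * m))) : Op m :=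
  (exists_permUnitary p).choose

theorem permUnitary_mem {m : ℕ} (p : Equiv.Perm (Fin (2 * m))) :
    permUnitary p ∈ Matrix.unitaryGroup (Bits m) ℂ :=
  (exists_permUnitary p).choose_spec.1

theorem permUnitary_conj {m : ℕ} (p : Equiv.Perm (Fin (2 * m))) (k : Fin (2 * m)) :
    permUnitary p * majorana k * (permUnitary p)ᴴ = majorana (p k) :=
  (exists_permUnitary p).choose_spec.2 k

/-! ### Randomized measurement, its channel, and the classical-shadow estimator -/

/-- The post-measurement state `U(p)† |b⟩⟨b| U(p)`. -/
noncomputable def snapshot {m : ℕ} (p : Equiv.Perm (Fin (2 * m))) (b : Bits m) : Op m :=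
  (permUnitary p)ᴴ * Matrix.single b b 1 * permUnitary p

/-- The expectation of `f p b` when `p` is a uniformly random permutation and `b` is the outcome
of measuring `U(p) ρ U(p)†` in the computational basis, which is
`(1 / (2 m)!) ∑ p, ∑ b, tr(ρ U(p)† |b⟩⟨b| U(p)) f p b`. -/
noncomputable def expectation {m : ℕ} {E : Type*} [AddCommGroup E] [Module ℂ E] (ρ : Op m)
    (f : Equiv.Perm (Fin (2 * m)) → Bits m → E) : E :=
  (1 / ((2 * m).factorial : ℂ)) • ∑ p : Equiv.Perm (Fin (2 * m)), ∑ b : Bits m,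
    (ρ * snapshot p b).trace • f p b

/-- The measurement channel `M(ρ)`, the expectation of `U(p)† |b⟩⟨b| U(p)`. -/
noncomputable def channel {m : ℕ} (ρ : Op m) : Op m := expectation ρ snapshot

/-- The span of the Majorana operators of even degree. -/
noncomputable def evenSubspace (m : ℕ) : Submodule ℂ (Op m) :=
  Submodule.span ℂ (Gam '' {μ | Even μ.card})

/-- The inverse of the channel on the even subspace: the even operator that the channel maps to
the given (even) operator. -/
noncomputable def invChannel {m : ℕ} : Op m → Op m :=
  Function.invFunOn channel (evenSubspace m : Set (Op m))

/-- The estimator `tr(H M⁻¹(U(p)† |b⟩⟨b| U(p)))` of `tr(H ρ)`. -/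
noncomputable def estimator {m : ℕ} (H : Op m) (p : Equiv.Perm (Fin (2 * m))) (b : Bits m) : ℂ :=
  (H * invChannel (snapshot p b)).trace

/-! ### The coefficients -/

/-- The number `λ_{m,k}` with `k = n / 2`, as a function of the degree `n`. -/
noncomputable def lam (m n : ℕ) : ℝ :=
  if Even n then (m.choose (n / 2) : ℝ) / ((2 * m).choose n : ℝ) else 0

/-- The multinomial coefficient `(a + b + c + d)! / (a! b! c! d!)`. -/
def multinomial₄ (a b c d : ℕ) : ℕ := Nat.multinomial Finset.univ ![a, b, c, d]

/-- The ratio of multinomial coefficients for integers `k`, `k'`, `a`, in the range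
`a ≤ k`, `a ≤ k'`, `k + k' ≤ m + a`, where no subtraction truncates. -/
noncomputable def lamInt (m k k' a : ℕ) : ℝ :=
  (multinomial₄ a (k - a) (k' - a) (m + a - k - k') : ℝ) /
    (multinomial₄ (2 * a) (2 * (k - a)) (2 * (k' - a)) (2 * (m + a - k - k')) : ℝ)

/-- The number `λ_{m,μ,μ'} = λ_{m,k,k',a}` with `k = |μ| / 2`, `k' = |μ'| / 2` and
`a = |μ ∩ μ'| / 2`. -/
noncomputable def lamPair {m : ℕ} (μ μ' : Finset (Fin (2 * m))) : ℝ :=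
  if Even μ.card ∧ Even μ'.card ∧ Even (μ ∩ μ').card then
    lamInt m (μ.card / 2) (μ'.card / 2) ((μ ∩ μ').card / 2)
  else 0

/-- The coefficient `κ_{m,μ,μ'}`. -/
noncomputable def kap {m : ℕ} (μ μ' : Finset (Fin (2 * m))) : ℝ :=
  lamPair μ μ' / (lam m μ.card * lam m μ'.card)

open Classical in
/-- The sign with `Γ_μ Γ_μ' = majSign μ μ' • Γ_{μ ∆ μ'}`, for `μ`, `μ'` and `μ ∩ μ'` of even
size. -/
noncomputable def majSign {m : ℕ} (μ μ' : Finset (Fin (2 * m))) : ℂ :=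
  if Gam μ * Gam μ' = Gam (symmDiff μ μ') then 1 else -1

/-- The coefficient `g_{μ μ'}` for the concatenated index sequence `μ μ'`, which stands for
`Γ_{μ μ'} = Γ_μ Γ_μ' = ± Γ_{μ ∆ μ'}`: it is `g_{μ ∆ μ'}` with the same sign. -/
noncomputable def prodCoeff {m : ℕ} (g : Finset (Fin (2 * m)) → ℂ)
    (μ μ' : Finset (Fin (2 * m))) : ℂ :=
  majSign μ μ' * g (symmDiff μ μ')

end MajoranaShadow

/-! Conjugation by `U(p)` turns `Γ_μ` into a phase times the product of the `γ_{p j}`, `j ∈ μ`. Each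
Majorana operator flips the bit of its own mode, so this product has nonzero diagonal entries only
if `p` sends `μ` onto a union of whole modes (`Aligned`), and then it is a diagonal matrix
(`rotDiag_eq_zero`, `rotGam_eq_diagonal`). The overlap of `Γ_μ` with a measured state is exactly
such a diagonal entry (`trace_Gam_mul_snapshot`).

Trace orthogonality of the `Γ_μ` becomes orthogonality of these entries under the sum over `b`
(`sum_rotDiag_mul_rotDiag`). Hence the channel is diagonal in the Majorana basis, and its eigenvalue
is the probability that `p` aligns `μ`. In the second moment three diagonal entries are multiplied.
Two of them merge, up to a sign, into the one of `μ ∆ μ'` (`rotDiag_mul_rotDiag`), orthogonality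
selects the coefficient of `ρ` there, and the remaining average is the probability that `p` aligns
`μ` and `μ'` at once.

Both probabilities are instances of one count (`card_aligned_div`): permutations that make a
coloring of the `2 m` indices constant on modes, for the coloring by one set or by the Venn regions
of two sets. -/

namespace MajoranaShadow

open Matrix

variable {m : ℕ}

/-! ### Products of Majorana operators -/

/-- The product of the Majorana operators of a list of indices. -/
noncomputable def listProd (l : List (Fin (2 * m))) : Op m := (l.map majorana).prod

@[simp] theorem listProd_nil : listProd ([] : List (Fin (2 * m))) = 1 := rfl

@[simp] theorem listProd_cons (j : Fin (2 * m)) (l : List (Fin (2 * m))) :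
    listProd (j :: l) = majorana j * listProd l := rfl

theorem Gam_eq (μ : Finset (Fin (2 * m))) :
    Gam μ = (-Complex.I) ^ (μ.card.choose 2) • listProd (μ.sort (· ≤ ·)) := rfl

/-- Distinct Majorana operators anticommute and equal ones commute, so each transposition costs at
most a sign. Only the existence of the sign matters later. -/
theorem listProd_perm {l l' : List (Fin (2 * m))} (h : l.Perm l') :
    listProd l = listProd l' ∨ listProd l = -listProd l' := by
  induction h with
  | nil => exact Or.inl rfl
  | cons j _ ih => rcases ih with ih | ih <;> simp [ih]
  | swap i j l =>
    by_cases h : i = j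
    · exact Or.inl (by rw [h])
    · right
      simp only [listProd_cons]
      rw [← mul_assoc, majorana_anticomm (Ne.symm h), neg_mul, mul_assoc]
  | trans _ _ ih₁ ih₂ =>
    rcases ih₁ with ih₁ | ih₁ <;> rcases ih₂ with ih₂ | ih₂ <;> simp [ih₁, ih₂]

/-- If `j` already occurs, it is moved to the front and cancels by `γ_j² = 1`; otherwise it is moved
to its sorted place. -/
theorem majorana_mul_listProd_sort (j : Fin (2 * m)) (μ : Finset (Fin (2 * m))) :
    majorana j * listProd (μ.sort (· ≤ ·)) = listProd ((symmDiff {j} μ).sort (· ≤ ·)) ∨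
      majorana j * listProd (μ.sort (· ≤ ·)) = -listProd ((symmDiff {j} μ).sort (· ≤ ·)) := by
  by_cases h : j ∈ μ
  · have hp : (μ.sort (· ≤ ·)).Perm (j :: (symmDiff {j} μ).sort (· ≤ ·)) := by
      rw [List.perm_ext_iff_of_nodup (Finset.sort_nodup _ _)
        (List.nodup_cons.2 ⟨by simp [Finset.mem_symmDiff, h], Finset.sort_nodup _ _⟩)]
      intro a
      by_cases ha : a = j <;> simp_all [Finset.mem_symmDiff]
    rcases listProd_perm hp with e | e <;> rw [e, listProd_cons]
    · rw [← mul_assoc, majorana_mul_self, one_mul]; exact Or.inl rfl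
    · rw [mul_neg, ← mul_assoc, majorana_mul_self, one_mul]; exact Or.inr rfl
  · have hp : (j :: μ.sort (· ≤ ·)).Perm ((symmDiff {j} μ).sort (· ≤ ·)) := by
      rw [List.perm_ext_iff_of_nodup (List.nodup_cons.2 ⟨by simpa using h, Finset.sort_nodup _ _⟩)
        (Finset.sort_nodup _ _)]
      intro a
      by_cases ha : a = j <;> simp_all [Finset.mem_symmDiff]
    exact listProd_perm hp

theorem listProd_mul_listProd_sort {l : List (Fin (2 * m))} (hl : l.Nodup)
    (ν : Finset (Fin (2 * m))) :
    listProd l * listProd (ν.sort (· ≤ ·)) =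
        listProd ((symmDiff l.toFinset ν).sort (· ≤ ·)) ∨
      listProd l * listProd (ν.sort (· ≤ ·)) =
        -listProd ((symmDiff l.toFinset ν).sort (· ≤ ·)) := by
  induction l with
  | nil => left; rw [listProd_nil, one_mul, List.toFinset_nil, ← Finset.bot_eq_empty, bot_symmDiff]
  | cons j l ih =>
    obtain ⟨hj, hl⟩ := List.nodup_cons.1 hl
    have e : (j :: l).toFinset = symmDiff {j} l.toFinset := by
      ext a
      by_cases ha : a = j <;> simp_all [Finset.mem_symmDiff]
    rw [e, symmDiff_assoc, listProd_cons, mul_assoc]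
    rcases ih hl with h | h <;> rw [h]
    · exact majorana_mul_listProd_sort _ _
    · rw [mul_neg]
      rcases majorana_mul_listProd_sort j (symmDiff l.toFinset ν) with h | h <;> rw [h]
      · exact Or.inr rfl
      · exact Or.inl (neg_neg _)

theorem listProd_sort_mul_listProd_sort (μ ν : Finset (Fin (2 * m))) :
    listProd (μ.sort (· ≤ ·)) * listProd (ν.sort (· ≤ ·)) =
        listProd ((symmDiff μ ν).sort (· ≤ ·)) ∨
      listProd (μ.sort (· ≤ ·)) * listProd (ν.sort (· ≤ ·)) =
        -listProd ((symmDiff μ ν).sort (· ≤ ·)) := by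
  simpa using listProd_mul_listProd_sort (Finset.sort_nodup μ (· ≤ ·)) ν

theorem majorana_mul_listProd {j : Fin (2 * m)} {l : List (Fin (2 * m))} (h : j ∉ l) :
    majorana j * listProd l = (-1 : ℂ) ^ l.length • (listProd l * majorana j) := by
  induction l with
  | nil => simp
  | cons i l ih =>
    rw [List.mem_cons, not_or] at h
    rw [listProd_cons, ← mul_assoc, majorana_anticomm h.1, neg_mul, mul_assoc, ih h.2,
      mul_smul_comm, List.length_cons, pow_succ, mul_assoc]
    simp

/-- Moving each head past its tail costs `(-1)` to the length of the tail; these lengths add up to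
`k choose 2`. The phase in `Gam` is chosen to cancel this sign. -/
theorem listProd_mul_self {l : List (Fin (2 * m))} (hl : l.Nodup) :
    listProd l * listProd l = (-1 : ℂ) ^ (l.length.choose 2) • (1 : Op m) := by
  induction l with
  | nil => simp
  | cons j l ih =>
    obtain ⟨hj, hl⟩ := List.nodup_cons.1 hl
    have h : listProd l * majorana j = (-1 : ℂ) ^ l.length • (majorana j * listProd l) := by
      rw [majorana_mul_listProd hj, smul_smul, ← mul_pow]
      simp
    rw [listProd_cons, mul_assoc, ← mul_assoc (listProd l), h, smul_mul_assoc, mul_assoc, ih hl,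
      mul_smul_comm, mul_smul_comm, mul_smul_comm, mul_one, majorana_mul_self, List.length_cons,
      Nat.choose_succ_succ, Nat.choose_one_right, pow_add, mul_smul]

theorem parityOp_mul_listProd (l : List (Fin (2 * m))) :
    parityOp m * listProd l = (-1 : ℂ) ^ l.length • (listProd l * parityOp m) := by
  induction l with
  | nil => simp
  | cons i l ih =>
    rw [listProd_cons, ← mul_assoc, parityOp_mul_majorana, neg_mul, mul_assoc, ih,
      mul_smul_comm, List.length_cons, pow_succ, mul_assoc]
    simp

/-- For even length the head anticommutes with the tail, and cyclicity gives `tr = -tr`. For odd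
length the head commutes with the tail, so the parity operator, which anticommutes with every
Majorana operator, takes its role. -/
theorem trace_listProd {l : List (Fin (2 * m))} (hl : l.Nodup) (h : l ≠ []) :
    (listProd l).trace = 0 := by
  rcases Nat.even_or_odd l.length with hk | hk
  · obtain ⟨j, l, rfl⟩ := List.exists_cons_of_ne_nil h
    have hk' : Odd l.length := by
      rw [List.length_cons, Nat.even_add_one, Nat.not_even_iff_odd] at hk
      exact hk
    have h1 : (listProd (j :: l)).trace = -(listProd (j :: l)).trace := by
      conv_lhs => rw [listProd_cons, majorana_mul_listProd (List.nodup_cons.1 hl).1,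
        hk'.neg_one_pow, neg_one_smul, Matrix.trace_neg, Matrix.trace_mul_comm, ← listProd_cons]
    exact self_eq_neg.1 h1
  · have h1 : (listProd l).trace = -(listProd l).trace := by
      conv_lhs => rw [← one_mul (listProd l), ← parityOp_mul_self, mul_assoc,
        parityOp_mul_listProd, hk.neg_one_pow, neg_one_smul, mul_neg, Matrix.trace_neg,
        Matrix.trace_mul_comm, mul_assoc, parityOp_mul_self, mul_one]
    exact self_eq_neg.1 h1

/-! ### The Majorana basis -/

theorem Gam_mul_self (μ : Finset (Fin (2 * m))) : Gam μ * Gam μ = 1 := by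
  rw [Gam_eq, smul_mul_smul_comm, listProd_mul_self (Finset.sort_nodup _ _), smul_smul,
    Finset.length_sort, ← mul_pow, ← mul_pow]
  simp

theorem trace_Gam_mul_Gam (μ ν : Finset (Fin (2 * m))) :
    (Gam μ * Gam ν).trace = if μ = ν then 2 ^ m else 0 := by
  split_ifs with h
  · rw [h, Gam_mul_self, Matrix.trace_one]
    simp
  · have h0 : (listProd ((symmDiff μ ν).sort (· ≤ ·))).trace = 0 := by
      refine trace_listProd (Finset.sort_nodup _ _) fun e => h ?_
      have := congrArg List.toFinset e
      rw [Finset.sort_toFinset, List.toFinset_nil, ← Finset.bot_eq_empty, symmDiff_eq_bot] at this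
      exact this
    rw [Gam_eq, Gam_eq, smul_mul_smul_comm, Matrix.trace_smul]
    rcases listProd_sort_mul_listProd_sort μ ν with e | e <;> rw [e] <;> simp [h0]

theorem linearIndependent_Gam : LinearIndependent ℂ (Gam (m := m)) := by
  rw [Fintype.linearIndependent_iff]
  intro c hc μ
  have := congrArg (fun X => (Gam μ * X).trace) hc
  simpa [Finset.mul_sum, Matrix.trace_sum, trace_Gam_mul_Gam] using this

/-- Dimension count: there are `2 ^ (2 m) = (2 ^ m) ^ 2` independent operators. -/
theorem span_range_Gam : Submodule.span ℂ (Set.range (Gam (m := m))) = ⊤ := by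
  refine linearIndependent_Gam.span_eq_top_of_card_eq_finrank' ?_
  rw [Module.finrank_matrix]
  simp [pow_mul, ← mul_pow, mul_comm 2 m, pow_two]

theorem sum_trace_smul_Gam (X : Op m) :
    X = ((2 : ℂ) ^ m)⁻¹ • ∑ μ, (Gam μ * X).trace • Gam μ := by
  obtain ⟨c, rfl⟩ : ∃ c : Finset (Fin (2 * m)) → ℂ, ∑ μ, c μ • Gam μ = X := by
    rw [← Submodule.mem_span_range_iff_exists_fun, span_range_Gam]
    trivial
  have : ∀ μ, (Gam μ * ∑ ν, c ν • Gam ν).trace = c μ * 2 ^ m := fun μ => by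
    simp [Finset.mul_sum, Matrix.trace_sum, trace_Gam_mul_Gam]
  simp only [this, Finset.smul_sum, smul_smul]
  refine Finset.sum_congr rfl fun μ _ => ?_
  congr 1
  field_simp

theorem card_symmDiff_add {α : Type*} [DecidableEq α] (s t : Finset α) :
    (symmDiff s t).card + 2 * (s ∩ t).card = s.card + t.card := by
  have h1 : (symmDiff s t).card = (s \ t).card + (t \ s).card := by
    rw [symmDiff_def, Finset.sup_eq_union, Finset.card_union_of_disjoint disjoint_sdiff_sdiff]
  have h2 := Finset.card_sdiff_add_card_inter s t
  have h3 := Finset.card_sdiff_add_card_inter t s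
  rw [Finset.inter_comm] at h3
  omega

/-- With `n = 2 k`, the exponents `k (2 k - 1)` and `k` differ by `2 k (k - 1)`, a multiple of `4`.
This makes the phase additive in the degree. -/
theorem neg_I_pow_choose_two {n : ℕ} (h : Even n) :
    (-Complex.I) ^ n.choose 2 = (-Complex.I) ^ (n / 2) := by
  have hsq : (-Complex.I) ^ 2 = -1 := by simp
  obtain ⟨k, rfl⟩ := h
  have h1 : (k + k).choose 2 + 2 * k = k + 2 * (k * k) := by
    rw [Nat.choose_two_right]
    rcases k with _ | k
    · rfl
    · have : (k + 1 + (k + 1)) * (k + 1 + (k + 1) - 1) = 2 * ((k + 1) * (2 * k + 1)) := by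
        rw [show k + 1 + (k + 1) - 1 = 2 * k + 1 by omega]
        ring
      rw [this, Nat.mul_div_cancel_left _ two_pos]
      ring
  have h2 : (k + k) / 2 = k := by omega
  have h3 := congrArg (fun n => (-Complex.I) ^ n) h1
  simp only [pow_add, pow_mul, hsq] at h3
  rw [h2]
  rcases neg_one_pow_eq_or ℂ k with e | e <;> simpa [e] using h3

/-- The half-degrees of `μ` and `ν` exceed that of `μ ∆ ν` by `|μ ∩ ν|`. Since this is even, the
phases differ by a power of `(-i)² = -1`, and no factor `±i` is left. -/
theorem Gam_mul_Gam {μ ν : Finset (Fin (2 * m))} (hμ : Even μ.card) (hν : Even ν.card)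
    (h : Even (μ ∩ ν).card) :
    Gam μ * Gam ν = Gam (symmDiff μ ν) ∨ Gam μ * Gam ν = -Gam (symmDiff μ ν) := by
  have hc := card_symmDiff_add μ ν
  have hs : Even (symmDiff μ ν).card := by
    rw [Nat.even_iff] at *
    omega
  have key : (-Complex.I) ^ (μ.card / 2) * (-Complex.I) ^ (ν.card / 2) =
      (-Complex.I) ^ ((symmDiff μ ν).card / 2) ∨
      (-Complex.I) ^ (μ.card / 2) * (-Complex.I) ^ (ν.card / 2) =
      -(-Complex.I) ^ ((symmDiff μ ν).card / 2) := by
    have : μ.card / 2 + ν.card / 2 = (symmDiff μ ν).card / 2 + 2 * ((μ ∩ ν).card / 2) := by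
      rw [Nat.even_iff] at *
      omega
    rw [← pow_add, this, pow_add, pow_mul]
    rcases neg_one_pow_eq_or ℂ ((μ ∩ ν).card / 2) with e | e <;> simp [e]
  rw [Gam_eq, Gam_eq, Gam_eq, smul_mul_smul_comm, neg_I_pow_choose_two hμ,
    neg_I_pow_choose_two hν, neg_I_pow_choose_two hs]
  rcases listProd_sort_mul_listProd_sort μ ν with e | e <;>
  rcases key with e' | e' <;>
  simp [e, e']

theorem Gam_mul_Gam_eq_majSign {μ ν : Finset (Fin (2 * m))} (hμ : Even μ.card) (hν : Even ν.card)
    (h : Even (μ ∩ ν).card) :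
    Gam μ * Gam ν = majSign μ ν • Gam (symmDiff μ ν) := by
  unfold majSign
  split_ifs with e
  · rw [one_smul]; exact e
  · rw [neg_one_smul]; exact (Gam_mul_Gam hμ hν h).resolve_left e

/-! ### Counting permutations -/

section Counting

variable {α ι : Type*} [Fintype α] [DecidableEq ι]

/-- The number of points at which `f` takes the value `i`. -/
def fiberCard (f : α → ι) (i : ι) : ℕ := (Finset.univ.filter fun a => f a = i).card

theorem fiberCard_comp_perm (f : α → ι) (p : Equiv.Perm α) : fiberCard (f ∘ p) = fiberCard f := by
  funext i
  refine Finset.card_bij (fun a _ => p a) (by simp) (fun a _ b _ h => p.injective h) fun b hb =>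
    ⟨p.symm b, by simpa using hb, by simp⟩

theorem exists_perm_comp_eq {f g : α → ι} (h : fiberCard g = fiberCard f) :
    ∃ p : Equiv.Perm α, g ∘ p = f := by
  have e : ∀ i, Nonempty ({a // f a = i} ≃ {a // g a = i}) := fun i => by
    refine ⟨Fintype.equivOfCardEq ?_⟩
    rw [Fintype.card_subtype, Fintype.card_subtype]
    exact (congrFun h i).symm
  exact ⟨Equiv.ofFiberEquiv fun i => (e i).some, funext fun a => Equiv.ofFiberEquiv_map _ a⟩

variable [Fintype ι]

theorem sum_fiberCard (f : α → ι) : ∑ i, fiberCard f i = Fintype.card α :=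
  (Finset.card_eq_sum_card_fiberwise fun _ _ => Finset.mem_univ _).symm

variable [DecidableEq α]

/-- The solutions form a coset of the stabilizer of `f`, which permutes each fiber freely. -/
theorem card_perm_comp_eq {f g : α → ι} (h : fiberCard g = fiberCard f) :
    (Finset.univ.filter fun p : Equiv.Perm α => g ∘ p = f).card =
      ∏ i, (fiberCard f i).factorial := by
  obtain ⟨q, hq⟩ := exists_perm_comp_eq h
  have h1 := DomMulAct.stabilizer_card f
  simp only [Fintype.card_subtype] at h1
  refine Eq.trans ?_ h1
  refine Finset.card_bij (fun p _ => q⁻¹ * p) ?_ (fun a _ b _ h => mul_left_cancel h) ?_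
  · intro p hp
    rw [Finset.mem_filter_univ] at hp ⊢
    funext a
    have hp' := congrFun hp a
    have hq' := congrFun hq (q⁻¹ (p a))
    simp_all
  · intro p hp
    rw [Finset.mem_filter_univ] at hp
    refine ⟨q * p, ?_, by simp⟩
    rw [Finset.mem_filter_univ, Equiv.Perm.coe_mul, ← Function.comp_assoc, hq, hp]

/-- Permutations are sorted by the coloring `f ∘ p`: every coloring with these fiber sizes arises `∏
(n i)!` times, and all `(∑ n i)!` permutations are used up. -/
theorem card_fiberCard_eq_mul {n : ι → ℕ} (hn : ∑ i, n i = Fintype.card α) :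
    (Finset.univ.filter fun g : α → ι => fiberCard g = n).card = Nat.multinomial Finset.univ n := by
  obtain ⟨f, hf⟩ : ∃ f : α → ι, fiberCard f = n := by
    have : Fintype.card α = Fintype.card (Σ i, Fin (n i)) := by simp [hn]
    let e := Fintype.equivOfCardEq this
    refine ⟨fun a => (e a).1, funext fun i => ?_⟩
    unfold fiberCard
    rw [← Fintype.card_subtype]
    rw [Fintype.card_congr (e.subtypeEquiv (q := fun x => x.1 = i) fun a => Iff.rfl),
      Fintype.card_congr (Equiv.sigmaSubtype i)]
    simp
  subst hf
  have h1 : ∑ g ∈ Finset.univ.filter (fun g : α → ι => fiberCard g = fiberCard f),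
      (Finset.univ.filter fun p : Equiv.Perm α => f ∘ p = g).card =
      (Fintype.card α).factorial := by
    rw [← Fintype.card_perm, ← Finset.card_univ]
    refine (Finset.card_eq_sum_card_fiberwise fun p _ => ?_).symm
    simp [fiberCard_comp_perm]
  rw [Finset.sum_congr rfl fun g hg => ?_, Finset.sum_const, smul_eq_mul, ← hn,
    ← Nat.multinomial_spec, mul_comm] at h1
  rotate_right
  · rw [Finset.mem_filter_univ] at hg
    rw [card_perm_comp_eq hg.symm, hg]
  exact Nat.eq_of_mul_eq_mul_left (Finset.prod_pos fun i _ => Nat.factorial_pos _) h1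

end Counting

/-! ### Permutations that align a coloring with the modes -/

theorem card_filter_mode_eq (i : Fin m) :
    (Finset.univ.filter fun j : Fin (2 * m) => mode j = i).card = 2 := by
  have : (Finset.univ.filter fun j : Fin (2 * m) => mode j = i) =
      {⟨2 * i.val, by omega⟩, ⟨2 * i.val + 1, by omega⟩} := by
    ext j
    simp only [Finset.mem_filter_univ, mode, Fin.ext_iff, Finset.mem_insert,
      Finset.mem_singleton]
    omega
  rw [this, Finset.card_pair]
  simp [Fin.ext_iff]

variable {ι : Type*} [DecidableEq ι]

theorem fiberCard_comp_mode (g : Fin m → ι) :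
    fiberCard (fun j : Fin (2 * m) => g (mode j)) = fun i => 2 * fiberCard g i := by
  funext i
  unfold fiberCard
  rw [Finset.card_eq_sum_card_fiberwise (f := mode)
    (t := Finset.univ.filter fun k : Fin m => g k = i) (fun j hj => by simpa using hj)]
  rw [Finset.sum_congr rfl fun k hk => ?_, Finset.sum_const, smul_eq_mul, mul_comm]
  rw [Finset.filter_filter]
  refine Eq.trans (congrArg Finset.card (Finset.ext fun j => ?_)) (card_filter_mode_eq k)
  simp only [Finset.mem_filter_univ] at hk ⊢
  exact ⟨fun h => h.2, fun h => ⟨h ▸ hk, h⟩⟩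

theorem mode_surjective : Function.Surjective (mode (m := m)) := fun i =>
  ⟨⟨2 * i.val, by omega⟩, by simp [mode]⟩

/-- The permutation `p` brings the coloring `f` to one that is constant on each mode. -/
def Aligned (f : Fin (2 * m) → ι) (p : Equiv.Perm (Fin (2 * m))) : Prop :=
  ∃ g : Fin m → ι, (fun j => g (mode j)) ∘ p = f

/-- Removes the mode coloring `g`, which can be read off along a section of `mode`. -/
theorem aligned_iff {ι : Type*} {f : Fin (2 * m) → ι} {p : Equiv.Perm (Fin (2 * m))} :
    Aligned f p ↔ ∀ j k, mode (p j) = mode (p k) → f j = f k := by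
  constructor
  · rintro ⟨g, rfl⟩ j k h
    exact congrArg g h
  · intro h
    refine ⟨fun k => f (p.symm (Function.surjInv mode_surjective k)), funext fun j => h _ _ ?_⟩
    rw [Equiv.apply_symm_apply, Function.surjInv_eq mode_surjective]

theorem Aligned.even_fiberCard {f : Fin (2 * m) → ι} {p : Equiv.Perm (Fin (2 * m))}
    (h : Aligned f p) (i : ι) : Even (fiberCard f i) := by
  obtain ⟨g, rfl⟩ := h
  rw [fiberCard_comp_perm, fiberCard_comp_mode]
  exact even_two_mul _

-- An aligned `p` determines the coloring `g` of the modes. Since a mode has two indices, the fibers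
-- of `g` are half those of `f`: a multinomial number of choices, each realized by `∏ (fiberCard f
-- i)!` permutations. Dividing by `(2 m)!` leaves the ratio of multinomials.
open Classical in
theorem card_aligned_div [Fintype ι] {f : Fin (2 * m) → ι} (hf : ∀ i, Even (fiberCard f i)) :
    ((Finset.univ.filter (Aligned f)).card : ℝ) / ((2 * m).factorial : ℝ) =
      (Nat.multinomial Finset.univ fun i => fiberCard f i / 2 : ℕ) /
        (Nat.multinomial Finset.univ (fiberCard f) : ℕ) := by
  have h2 : ∀ i, 2 * (fiberCard f i / 2) = fiberCard f i := fun i =>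
    Nat.two_mul_div_two_of_even (hf i)
  have hs : ∑ i, fiberCard f i / 2 = Fintype.card (Fin m) := by
    have := sum_fiberCard f
    rw [← Finset.sum_congr rfl fun i _ => h2 i, ← Finset.mul_sum] at this
    simpa using this
  have hcard : (Finset.univ.filter (Aligned f)).card =
      (Nat.multinomial Finset.univ fun i => fiberCard f i / 2) *
        ∏ i, (fiberCard f i).factorial := by
    have hfib : ∀ g ∈ Finset.univ.filter fun g : Fin m → ι =>
        fiberCard g = fun i => fiberCard f i / 2,
        (Finset.univ.filter fun p : Equiv.Perm (Fin (2 * m)) =>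
          (fun j => g (mode j)) ∘ p = f).card = ∏ i, (fiberCard f i).factorial := by
      intro g hg
      refine card_perm_comp_eq ?_
      rw [Finset.mem_filter_univ] at hg
      rw [fiberCard_comp_mode, hg]
      exact funext h2
    have hsum := Finset.sum_congr rfl hfib
    rw [Finset.sum_const, smul_eq_mul, card_fiberCard_eq_mul hs, ← Finset.card_biUnion] at hsum
    · rw [← hsum]
      congr 1
      ext p
      simp only [Finset.mem_filter_univ, Finset.mem_biUnion]
      refine ⟨fun ⟨g, hg⟩ => ⟨g, ?_, hg⟩, fun ⟨g, _, hg⟩ => ⟨g, hg⟩⟩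
      rw [← hg, fiberCard_comp_perm, fiberCard_comp_mode]
      funext i
      change fiberCard g i = 2 * fiberCard g i / 2
      omega
    · intro g _ g' _ hne
      rw [Function.onFun, Finset.disjoint_left]
      intro p hp hp'
      rw [Finset.mem_filter_univ] at hp hp'
      refine hne (funext fun k => ?_)
      obtain ⟨j, rfl⟩ := mode_surjective k
      -- Every mode is hit by `mode ∘ p`, so `p` and `f` determine `g`.
      have := congrFun (hp.trans hp'.symm) (p.symm j)
      simpa using this
  have hspec := Nat.multinomial_spec Finset.univ (fiberCard f)
  rw [sum_fiberCard, Fintype.card_fin] at hspec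
  have hP : (∏ i, (fiberCard f i).factorial : ℝ) ≠ 0 :=
    Finset.prod_ne_zero_iff.2 fun i _ => by positivity
  have hM : ((Nat.multinomial Finset.univ (fiberCard f) : ℕ) : ℝ) ≠ 0 := by
    exact_mod_cast (Nat.multinomial_pos _ _).ne'
  rw [hcard, ← hspec]
  push_cast
  field_simp

/-! ### Colorings by index sets -/

/-- The coloring that tells a set from its complement. -/
def setColoring (μ : Finset (Fin (2 * m))) (j : Fin (2 * m)) : Fin 2 := if j ∈ μ then 0 else 1

/-- The coloring by the four regions of the Venn diagram of two sets. -/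
def vennColoring (μ μ' : Finset (Fin (2 * m))) (j : Fin (2 * m)) : Fin 4 :=
  if j ∈ μ then (if j ∈ μ' then 0 else 1) else (if j ∈ μ' then 2 else 3)

theorem aligned_setColoring_iff {μ : Finset (Fin (2 * m))} {p : Equiv.Perm (Fin (2 * m))} :
    Aligned (setColoring μ) p ↔ ∀ j k, mode (p j) = mode (p k) → (j ∈ μ ↔ k ∈ μ) := by
  rw [aligned_iff]
  refine forall₃_congr fun j k _ => ?_
  unfold setColoring
  split_ifs <;> simp_all

/-- Simultaneous alignment of two sets is alignment of a single coloring, so the general count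
applies to it. -/
theorem aligned_vennColoring_iff {μ μ' : Finset (Fin (2 * m))} {p : Equiv.Perm (Fin (2 * m))} :
    Aligned (vennColoring μ μ') p ↔ Aligned (setColoring μ) p ∧ Aligned (setColoring μ') p := by
  rw [aligned_setColoring_iff, aligned_setColoring_iff, aligned_iff, ← forall_and]
  refine forall_congr' fun j => ?_
  rw [← forall_and]
  refine forall_congr' fun k => ?_
  rw [← imp_and]
  refine imp_congr_right fun _ => ?_
  unfold vennColoring
  split_ifs <;> simp_all

theorem fiberCard_setColoring (μ : Finset (Fin (2 * m))) :
    fiberCard (setColoring μ) = ![μ.card, 2 * m - μ.card] := by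
  have h : ∀ j, (setColoring μ j = 0 ↔ j ∈ μ) ∧ (setColoring μ j = 1 ↔ j ∈ μᶜ) := fun j => by
    unfold setColoring
    split_ifs <;> simp_all
  funext i
  fin_cases i <;> unfold fiberCard <;> simp [h, Finset.filter_not, Finset.card_sdiff]

theorem fiberCard_vennColoring (μ μ' : Finset (Fin (2 * m))) :
    fiberCard (vennColoring μ μ') = ![(μ ∩ μ').card, μ.card - (μ ∩ μ').card,
      μ'.card - (μ ∩ μ').card, 2 * m + (μ ∩ μ').card - μ.card - μ'.card] := by
  have h : ∀ j, (vennColoring μ μ' j = 0 ↔ j ∈ μ ∩ μ') ∧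
      (vennColoring μ μ' j = 1 ↔ j ∈ μ \ μ') ∧ (vennColoring μ μ' j = 2 ↔ j ∈ μ' \ μ) ∧
      (vennColoring μ μ' j = 3 ↔ j ∈ (μ ∪ μ')ᶜ) := fun j => by
    unfold vennColoring
    split_ifs <;> simp_all
  have h' := Finset.card_union_add_card_inter μ μ'
  funext i
  fin_cases i <;> unfold fiberCard
  · simp only [Fin.zero_eta, (h _).1, Finset.filter_univ_mem]; rfl
  · simp only [Fin.mk_one, (h _).2.1, Finset.filter_univ_mem]
    rw [Finset.card_sdiff, Finset.inter_comm]; rfl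
  · simp only [Fin.reduceFinMk, (h _).2.2.1, Finset.filter_univ_mem]
    rw [Finset.card_sdiff]; rfl
  · simp only [Fin.reduceFinMk, (h _).2.2.2, Finset.filter_univ_mem]
    rw [Finset.card_compl, Fintype.card_fin]
    change _ = 2 * m + (μ ∩ μ').card - μ.card - μ'.card
    omega

theorem card_le_two_mul (μ : Finset (Fin (2 * m))) : μ.card ≤ 2 * m := by
  simpa using Finset.card_le_univ μ

theorem Aligned.even_card {μ : Finset (Fin (2 * m))} {p : Equiv.Perm (Fin (2 * m))}
    (h : Aligned (setColoring μ) p) : Even μ.card := by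
  simpa [fiberCard_setColoring] using h.even_fiberCard 0

theorem Aligned.even_card_inter {μ μ' : Finset (Fin (2 * m))} {p : Equiv.Perm (Fin (2 * m))}
    (h : Aligned (vennColoring μ μ') p) : Even (μ ∩ μ').card := by
  simpa [fiberCard_vennColoring] using h.even_fiberCard 0

open Classical in
theorem card_aligned_setColoring (μ : Finset (Fin (2 * m))) :
    ((Finset.univ.filter (Aligned (setColoring μ))).card : ℝ) / ((2 * m).factorial : ℝ) =
      lam m μ.card := by
  unfold lam
  split_ifs with h
  · have hle := card_le_two_mul μ
    have hc := fiberCard_setColoring μ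
    have he : ∀ i, Even (fiberCard (setColoring μ) i) := fun i => by
      rw [hc, Nat.even_iff] at *
      fin_cases i
      · exact h
      · change (2 * m - μ.card) % 2 = 0
        omega
    rw [card_aligned_div he, hc]
    have e : (fun i => (![μ.card, 2 * m - μ.card] : Fin 2 → ℕ) i / 2) =
        ![μ.card / 2, m - μ.card / 2] := by
      rw [Nat.even_iff] at h
      funext i
      fin_cases i
      · rfl
      · change (2 * m - μ.card) / 2 = m - μ.card / 2
        omega
    rw [e, Nat.multinomial_univ_two, Nat.multinomial_univ_two, Nat.choose_eq_factorial_div_factorial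
      hle, Nat.choose_eq_factorial_div_factorial (by omega), Nat.add_sub_cancel' hle,
      Nat.add_sub_cancel' (by omega)]
  · rw [Finset.filter_eq_empty_iff.2 fun p _ hp => h (Aligned.even_card hp)]
    simp

open Classical in
theorem card_aligned_vennColoring (μ μ' : Finset (Fin (2 * m))) :
    ((Finset.univ.filter (Aligned (vennColoring μ μ'))).card : ℝ) / ((2 * m).factorial : ℝ) =
      lamPair μ μ' := by
  unfold lamPair
  split_ifs with h
  · obtain ⟨h1, h2, h3⟩ := h
    have hu := Finset.card_union_add_card_inter μ μ'
    have hle := card_le_two_mul (μ ∪ μ')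
    have hi := Finset.card_le_card (Finset.inter_subset_left (s₁ := μ) (s₂ := μ'))
    have hi' := Finset.card_le_card (Finset.inter_subset_right (s₁ := μ) (s₂ := μ'))
    obtain ⟨a, ha⟩ := h3
    obtain ⟨k, hk⟩ := h1
    obtain ⟨k', hk'⟩ := h2
    have hc := fiberCard_vennColoring μ μ'
    have hc' : fiberCard (vennColoring μ μ') =
        ![2 * a, 2 * (k - a), 2 * (k' - a), 2 * (m + a - k - k')] := by
      rw [hc, show μ.card - (μ ∩ μ').card = 2 * (k - a) by omega,
        show μ'.card - (μ ∩ μ').card = 2 * (k' - a) by omega,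
        show 2 * m + (μ ∩ μ').card - μ.card - μ'.card = 2 * (m + a - k - k') by omega,
        show (μ ∩ μ').card = 2 * a by omega]
    have he : ∀ i, Even (fiberCard (vennColoring μ μ') i) := fun i => by
      rw [hc']
      fin_cases i <;> exact even_two_mul _
    have e : (fun i => fiberCard (vennColoring μ μ') i / 2) =
        ![a, k - a, k' - a, m + a - k - k'] := by
      rw [hc']
      funext i
      fin_cases i <;> exact Nat.mul_div_cancel_left _ two_pos
    rw [card_aligned_div he, e, hc', ha, hk, hk', ← two_mul, ← two_mul, ← two_mul,
      Nat.mul_div_cancel_left _ two_pos, Nat.mul_div_cancel_left _ two_pos,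
      Nat.mul_div_cancel_left _ two_pos]
    rfl
  · rw [Finset.filter_eq_empty_iff.2 fun p _ hp => h ⟨(aligned_vennColoring_iff.1 hp).1.even_card,
      (aligned_vennColoring_iff.1 hp).2.even_card, hp.even_card_inter⟩]
    simp

theorem lam_ne_zero {μ : Finset (Fin (2 * m))} (h : Even μ.card) : lam m μ.card ≠ 0 := by
  have hle := card_le_two_mul μ
  unfold lam
  rw [if_pos h]
  have h1 : m.choose (μ.card / 2) ≠ 0 := (Nat.choose_pos (by omega)).ne'
  have h2 : (2 * m).choose μ.card ≠ 0 := (Nat.choose_pos hle).ne'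
  positivity

/-! ### Diagonal entries of rotated Majorana operators -/

/-- A factor in mode `i` flips bit `i` and no other, so only the parity of the number of such
factors matters. -/
theorem eq_of_listProd_apply_ne_zero {l : List (Fin (2 * m))} {y x : Bits m}
    (h : listProd l y x ≠ 0) (i : Fin m) :
    y i = (x i).xor (decide (Odd (l.countP fun j => mode j = i))) := by
  induction l generalizing y with
  | nil =>
    rw [listProd_nil, Matrix.one_apply] at h
    have : y = x := by by_contra hne; simp [hne] at h
    simp [this]
  | cons j l ih =>
    rw [listProd_cons, Matrix.mul_apply] at h
    obtain ⟨z, -, hz⟩ := Finset.exists_ne_zero_of_sum_ne_zero h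
    have hzx := ih (right_ne_zero_of_mul hz)
    have hyz : y = flipBit (mode j) z := by
      by_contra hne
      have := left_ne_zero_of_mul hz
      rw [majorana_apply, if_neg hne] at this
      exact this rfl
    rw [hyz, List.countP_cons]
    by_cases hi : mode j = i
    · subst hi
      have hodd : ∀ n : ℕ, decide (Odd (n + 1)) = !decide (Odd n) := fun n => by
        rw [← decide_not, decide_eq_decide, Nat.odd_add_one]
      simp only [flipBit, Function.update_self, decide_true, if_true, hodd, hzx, Bool.xor_not]
    · simp [flipBit, Function.update_of_ne (Ne.symm hi), hi, hzx]

/-- The rotated Majorana operator `U(p) Γ_μ U(p)†`. -/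
noncomputable def rotGam (p : Equiv.Perm (Fin (2 * m))) (μ : Finset (Fin (2 * m))) : Op m :=
  permUnitary p * Gam μ * (permUnitary p)ᴴ

/-- The diagonal entries of the rotated Majorana operator. -/
noncomputable def rotDiag (p : Equiv.Perm (Fin (2 * m))) (μ : Finset (Fin (2 * m)))
    (b : Bits m) : ℂ := rotGam p μ b b

theorem permUnitary_conjTranspose_mul (p : Equiv.Perm (Fin (2 * m))) :
    (permUnitary p)ᴴ * permUnitary p = 1 :=
  Matrix.mem_unitaryGroup_iff'.1 (permUnitary_mem p)

theorem permUnitary_mul_conjTranspose (p : Equiv.Perm (Fin (2 * m))) :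
    permUnitary p * (permUnitary p)ᴴ = 1 :=
  Matrix.mem_unitaryGroup_iff.1 (permUnitary_mem p)

theorem permUnitary_conj_mul (p : Equiv.Perm (Fin (2 * m))) (X Y : Op m) :
    (permUnitary p * X * (permUnitary p)ᴴ) * (permUnitary p * Y * (permUnitary p)ᴴ) =
      permUnitary p * (X * Y) * (permUnitary p)ᴴ := by
  calc _ = permUnitary p * X * ((permUnitary p)ᴴ * permUnitary p) * (Y * (permUnitary p)ᴴ) := by
        simp only [mul_assoc]
    _ = _ := by rw [permUnitary_conjTranspose_mul, mul_one]; simp only [mul_assoc]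

theorem permUnitary_conj_listProd (p : Equiv.Perm (Fin (2 * m))) (l : List (Fin (2 * m))) :
    permUnitary p * listProd l * (permUnitary p)ᴴ = listProd (l.map p) := by
  induction l with
  | nil => simp [permUnitary_mul_conjTranspose]
  | cons j l ih =>
    rw [listProd_cons, ← permUnitary_conj_mul, ih, permUnitary_conj, List.map_cons, listProd_cons]

theorem rotGam_eq (p : Equiv.Perm (Fin (2 * m))) (μ : Finset (Fin (2 * m))) :
    rotGam p μ = (-Complex.I) ^ (μ.card.choose 2) • listProd ((μ.sort (· ≤ ·)).map p) := by
  rw [rotGam, Gam_eq, mul_smul_comm, smul_mul_assoc, permUnitary_conj_listProd]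

theorem rotGam_mul_rotGam (p : Equiv.Perm (Fin (2 * m))) (μ ν : Finset (Fin (2 * m))) :
    rotGam p μ * rotGam p ν = permUnitary p * (Gam μ * Gam ν) * (permUnitary p)ᴴ :=
  permUnitary_conj_mul p _ _

theorem trace_rotGam_mul_rotGam (p : Equiv.Perm (Fin (2 * m))) (μ ν : Finset (Fin (2 * m))) :
    (rotGam p μ * rotGam p ν).trace = if μ = ν then 2 ^ m else 0 := by
  rw [rotGam_mul_rotGam, Matrix.trace_mul_comm, ← mul_assoc, permUnitary_conjTranspose_mul,
    one_mul, trace_Gam_mul_Gam]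

theorem countP_map_sort (p : Equiv.Perm (Fin (2 * m))) (μ : Finset (Fin (2 * m))) (i : Fin m) :
    (((μ.sort (· ≤ ·)).map p).countP fun j => mode j = i) =
      (μ.filter fun j => mode (p j) = i).card := by
  rw [List.countP_map, List.countP_eq_length_filter,
    ← List.toFinset_card_of_nodup ((Finset.sort_nodup _ _).filter _), List.toFinset_filter,
    Finset.sort_toFinset]
  simp

theorem card_filter_mode_perm_eq (p : Equiv.Perm (Fin (2 * m))) (i : Fin m) :
    (Finset.univ.filter fun j => mode (p j) = i).card = 2 := by
  refine Eq.trans ?_ (card_filter_mode_eq i)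
  exact Finset.card_bij (fun j _ => p j) (by simp) (fun a _ b _ h => p.injective h)
    fun j hj => ⟨p.symm j, by simpa using hj, by simp⟩

/-- A mode receives exactly two indices under `p`, so an even number of them from `μ` means none or
both. -/
theorem aligned_setColoring_iff_even {μ : Finset (Fin (2 * m))} {p : Equiv.Perm (Fin (2 * m))} :
    Aligned (setColoring μ) p ↔ ∀ i, Even (μ.filter fun j => mode (p j) = i).card := by
  rw [aligned_setColoring_iff]
  constructor
  · intro h i
    by_cases hi : ∃ j ∈ μ, mode (p j) = i
    · obtain ⟨j, hj, rfl⟩ := hi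
      have : (μ.filter fun k => mode (p k) = mode (p j)) =
          Finset.univ.filter fun k => mode (p k) = mode (p j) := by
        ext k
        simp only [Finset.mem_filter, Finset.mem_univ, true_and, and_iff_right_iff_imp]
        exact fun hk => (h k j hk).2 hj
      rw [this, card_filter_mode_perm_eq]
      exact even_two
    · rw [Finset.filter_eq_empty_iff.2 fun j hj e => hi ⟨j, hj, e⟩]
      simp
  · intro h
    have key : ∀ j k, mode (p j) = mode (p k) → j ∈ μ → k ∈ μ := by
      intro j k hjk hj
      have hsub : (μ.filter fun a => mode (p a) = mode (p j)) ⊆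
          Finset.univ.filter fun a => mode (p a) = mode (p j) :=
        Finset.filter_subset_filter _ (Finset.subset_univ _)
      have hpos : 0 < (μ.filter fun a => mode (p a) = mode (p j)).card :=
        Finset.card_pos.2 ⟨j, by simp [hj]⟩
      have hev := h (mode (p j))
      have heq := Finset.eq_of_subset_of_card_le hsub (by
        rw [card_filter_mode_perm_eq]
        rw [Nat.even_iff] at hev
        omega)
      have hk : k ∈ μ.filter fun a => mode (p a) = mode (p j) := by
        rw [heq]
        simp [hjk]
      exact (Finset.mem_filter.1 hk).1
    exact fun j k hjk => ⟨key j k hjk, key k j hjk.symm⟩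

theorem rotDiag_eq_zero {p : Equiv.Perm (Fin (2 * m))} {μ : Finset (Fin (2 * m))}
    (h : ¬ Aligned (setColoring μ) p) (b : Bits m) : rotDiag p μ b = 0 := by
  by_contra hne
  rw [rotDiag, rotGam_eq, Matrix.smul_apply, smul_eq_mul] at hne
  refine h (aligned_setColoring_iff_even.2 fun i => ?_)
  have := eq_of_listProd_apply_ne_zero (right_ne_zero_of_mul hne) i
  rw [countP_map_sort] at this
  rw [← Nat.not_odd_iff_even]
  intro ho
  simp [ho] at this

theorem rotGam_eq_diagonal {p : Equiv.Perm (Fin (2 * m))} {μ : Finset (Fin (2 * m))}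
    (h : Aligned (setColoring μ) p) : rotGam p μ = Matrix.diagonal (rotDiag p μ) := by
  ext y x
  by_cases hyx : y = x
  · rw [hyx, Matrix.diagonal_apply_eq, rotDiag]
  · rw [Matrix.diagonal_apply_ne _ hyx]
    by_contra hne
    rw [rotGam_eq, Matrix.smul_apply, smul_eq_mul] at hne
    refine hyx (funext fun i => ?_)
    have := eq_of_listProd_apply_ne_zero (right_ne_zero_of_mul hne) i
    rw [countP_map_sort] at this
    simpa [Nat.not_odd_iff_even.2 (aligned_setColoring_iff_even.1 h i)] using this

-- One aligned factor suffices: its rotated operator is diagonal, so the trace of the product sees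
-- only the diagonal of the other.
open Classical in
theorem sum_rotDiag_mul_rotDiag (p : Equiv.Perm (Fin (2 * m))) (μ ν : Finset (Fin (2 * m))) :
    ∑ b, rotDiag p μ b * rotDiag p ν b =
      if μ = ν ∧ Aligned (setColoring μ) p then 2 ^ m else 0 := by
  by_cases h : Aligned (setColoring μ) p
  · have := trace_rotGam_mul_rotGam p μ ν
    rw [rotGam_eq_diagonal h, Matrix.trace] at this
    simp only [Matrix.diag_apply, Matrix.diagonal_mul] at this
    simpa [h, rotDiag] using this
  · simp [rotDiag_eq_zero h, h]

/-- Both rotated operators are diagonal, so the operator identity `Γ_μ Γ_ν = ± Γ_{μ ∆ ν}` holds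
entry by entry. -/
theorem rotDiag_mul_rotDiag {p : Equiv.Perm (Fin (2 * m))} {μ ν : Finset (Fin (2 * m))}
    (h : Aligned (vennColoring μ ν) p) (b : Bits m) :
    rotDiag p μ b * rotDiag p ν b = majSign μ ν * rotDiag p (symmDiff μ ν) b := by
  obtain ⟨hμ, hν⟩ := aligned_vennColoring_iff.1 h
  have e := rotGam_mul_rotGam p μ ν
  rw [Gam_mul_Gam_eq_majSign hμ.even_card hν.even_card h.even_card_inter, mul_smul_comm,
    smul_mul_assoc, ← rotGam, rotGam_eq_diagonal hμ, rotGam_eq_diagonal hν,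
    Matrix.diagonal_mul_diagonal] at e
  simpa [rotDiag] using congrFun (congrFun e b) b

theorem Aligned.symmDiff {p : Equiv.Perm (Fin (2 * m))} {μ ν : Finset (Fin (2 * m))}
    (h : Aligned (vennColoring μ ν) p) : Aligned (setColoring (symmDiff μ ν)) p := by
  rw [aligned_vennColoring_iff, aligned_setColoring_iff, aligned_setColoring_iff] at h
  rw [aligned_setColoring_iff]
  intro j k hjk
  rw [Finset.mem_symmDiff, Finset.mem_symmDiff, h.1 j k hjk, h.2 j k hjk]

/-! ### The measured states and the channel -/

theorem trace_Gam_mul_snapshot (p : Equiv.Perm (Fin (2 * m))) (b : Bits m)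
    (μ : Finset (Fin (2 * m))) : (Gam μ * snapshot p b).trace = rotDiag p μ b := by
  rw [snapshot, ← mul_assoc, Matrix.trace_mul_comm, ← mul_assoc, ← mul_assoc, ← rotGam]
  simp [rotDiag, Matrix.trace_mul_single]

theorem ext_trace_Gam_mul {X Y : Op m} (h : ∀ μ, (Gam μ * X).trace = (Gam μ * Y).trace) :
    X = Y := by
  rw [sum_trace_smul_Gam X, sum_trace_smul_Gam Y]
  simp only [h]

/-- By orthogonality, lying in the even span means having no odd coefficients; this form is what the
channel acts on simply. -/
theorem mem_evenSubspace_iff {X : Op m} :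
    X ∈ evenSubspace m ↔ ∀ μ : Finset (Fin (2 * m)), ¬ Even μ.card → (Gam μ * X).trace = 0 := by
  constructor
  · intro hX μ hμ
    induction hX using Submodule.span_induction with
    | mem X hX =>
      obtain ⟨ν, hν, rfl⟩ := hX
      rw [trace_Gam_mul_Gam, if_neg]
      rintro rfl
      exact hμ hν
    | zero => simp
    | add X Y _ _ hX hY => rw [mul_add, Matrix.trace_add, hX, hY, add_zero]
    | smul c X _ hX => rw [mul_smul_comm, Matrix.trace_smul, hX, smul_zero]
  · intro h
    rw [sum_trace_smul_Gam X]
    refine Submodule.smul_mem _ _ (Submodule.sum_mem _ fun μ _ => ?_)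
    by_cases hμ : Even μ.card
    · exact Submodule.smul_mem _ _ (Submodule.subset_span ⟨μ, hμ, rfl⟩)
    · rw [h μ hμ, zero_smul]
      exact zero_mem _

theorem snapshot_mem_evenSubspace (p : Equiv.Perm (Fin (2 * m))) (b : Bits m) :
    snapshot p b ∈ evenSubspace m :=
  mem_evenSubspace_iff.2 fun μ hμ => by
    rw [trace_Gam_mul_snapshot, rotDiag_eq_zero fun h => hμ h.even_card]

open Classical in
theorem expectation_ite_aligned {ι : Type*} [DecidableEq ι] (f : Fin (2 * m) → ι) (c : ℂ) :
    (1 / ((2 * m).factorial : ℂ)) * ∑ p, (if Aligned f p then c else 0) =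
      (((Finset.univ.filter (Aligned f)).card : ℝ) / ((2 * m).factorial : ℝ) : ℝ) * c := by
  rw [← Finset.sum_filter, Finset.sum_const, nsmul_eq_mul]
  push_cast
  ring

theorem trace_Gam_mul_channel_Gam (μ ν : Finset (Fin (2 * m))) :
    (Gam ν * channel (Gam μ)).trace = lam m μ.card * (Gam ν * Gam μ).trace := by
  classical
  simp only [channel, expectation, mul_smul_comm, Matrix.trace_smul, Finset.mul_sum,
    Matrix.trace_sum, trace_Gam_mul_snapshot, smul_eq_mul, trace_Gam_mul_Gam]
  simp only [← Finset.mul_sum, sum_rotDiag_mul_rotDiag]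
  rw [← card_aligned_setColoring, ← expectation_ite_aligned]
  congr 1
  refine Finset.sum_congr rfl fun p _ => ?_
  by_cases h : μ = ν
  · simp [h]
  · simp [h, Ne.symm h]

theorem channel_Gam (μ : Finset (Fin (2 * m))) :
    channel (Gam μ) = (lam m μ.card : ℂ) • Gam μ :=
  ext_trace_Gam_mul fun ν => by
    rw [trace_Gam_mul_channel_Gam, mul_smul_comm, Matrix.trace_smul, smul_eq_mul]

theorem channel_smul (c : ℂ) (X : Op m) : channel (c • X) = c • channel X := by
  simp only [channel, expectation, smul_mul_assoc, Matrix.trace_smul, smul_assoc,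
    ← Finset.smul_sum]
  rw [smul_comm]

theorem channel_sum {ι : Type*} (s : Finset ι) (X : ι → Op m) :
    channel (∑ i ∈ s, X i) = ∑ i ∈ s, channel (X i) := by
  simp only [channel, expectation, Finset.sum_mul, Matrix.trace_sum, Finset.sum_smul,
    Finset.smul_sum]
  symm
  rw [Finset.sum_comm]
  refine Finset.sum_congr rfl fun p _ => ?_
  rw [Finset.sum_comm]

theorem trace_Gam_mul_channel (ν : Finset (Fin (2 * m))) (X : Op m) :
    (Gam ν * channel X).trace = lam m ν.card * (Gam ν * X).trace := by
  conv_lhs => rw [sum_trace_smul_Gam X]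
  simp only [channel_smul, channel_sum, channel_Gam, mul_smul_comm, Matrix.trace_smul,
    Finset.mul_sum, Matrix.trace_sum, trace_Gam_mul_Gam, smul_eq_mul, mul_ite, mul_zero,
    Finset.sum_ite_eq, Finset.mem_univ, if_true]
  field_simp

theorem channel_bijOn :
    Set.BijOn (channel (m := m)) (evenSubspace m) (evenSubspace m) := by
  refine ⟨fun X hX => ?_, fun X hX Y hY h => ?_, fun Y hY => ?_⟩
  · rw [SetLike.mem_coe, mem_evenSubspace_iff] at *
    intro μ hμ
    rw [trace_Gam_mul_channel, hX μ hμ, mul_zero]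
  · rw [SetLike.mem_coe, mem_evenSubspace_iff] at *
    refine ext_trace_Gam_mul fun μ => ?_
    by_cases hμ : Even μ.card
    · have := congrArg (fun Z => (Gam μ * Z).trace) h
      simp only [trace_Gam_mul_channel] at this
      exact mul_left_cancel₀ (by exact_mod_cast lam_ne_zero hμ) this
    · rw [hX μ hμ, hY μ hμ]
  · rw [SetLike.mem_coe, mem_evenSubspace_iff] at hY
    -- The preimage of `Y` divides each coefficient by its eigenvalue. In odd degree `lam` is `0`,
    -- whose inverse is `0` here; this is harmless, as `Y` has no odd coefficients.
    have key : ∀ μ : Finset (Fin (2 * m)), (Gam μ * ((2 : ℂ) ^ m)⁻¹ • ∑ ν : Finset (Fin (2 * m)),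
        ((lam m ν.card : ℂ)⁻¹ * (Gam ν * Y).trace) • Gam ν).trace =
        (lam m μ.card : ℂ)⁻¹ * (Gam μ * Y).trace := fun μ => by
      simp only [mul_smul_comm, Matrix.trace_smul, Finset.mul_sum, Matrix.trace_sum,
        trace_Gam_mul_Gam, smul_eq_mul, mul_ite, mul_zero, Finset.sum_ite_eq, Finset.mem_univ,
        if_true]
      field_simp
    refine ⟨((2 : ℂ) ^ m)⁻¹ • ∑ ν : Finset (Fin (2 * m)),
        ((lam m ν.card : ℂ)⁻¹ * (Gam ν * Y).trace) • Gam ν,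
      mem_evenSubspace_iff.2 fun μ hμ => ?_, ext_trace_Gam_mul fun μ => ?_⟩
    · rw [key, hY μ hμ, mul_zero]
    · rw [trace_Gam_mul_channel, key]
      by_cases hμ : Even μ.card
      · rw [mul_inv_cancel_left₀ (by exact_mod_cast lam_ne_zero hμ)]
      · rw [hY μ hμ, mul_zero, mul_zero]

theorem trace_Gam_mul_invChannel {μ : Finset (Fin (2 * m))} (hμ : Even μ.card) {X : Op m}
    (hX : X ∈ evenSubspace m) :
    (Gam μ * invChannel X).trace = (lam m μ.card : ℂ)⁻¹ * (Gam μ * X).trace := by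
  have h : channel (invChannel X) = X := channel_bijOn.surjOn.rightInvOn_invFunOn hX
  have := trace_Gam_mul_channel μ (invChannel X)
  rw [h] at this
  rw [this, inv_mul_cancel_left₀ (by exact_mod_cast lam_ne_zero hμ)]

theorem estimator_sum_smul_Gam (h : Finset (Fin (2 * m)) → ℂ) (p : Equiv.Perm (Fin (2 * m)))
    (b : Bits m) :
    estimator (∑ μ : Finset (Fin (2 * m)) with Even μ.card, h μ • Gam μ) p b =
      ∑ μ : Finset (Fin (2 * m)) with Even μ.card,
        h μ * (lam m μ.card : ℂ)⁻¹ * rotDiag p μ b := by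
  rw [estimator, Finset.sum_mul, Matrix.trace_sum]
  refine Finset.sum_congr rfl fun μ hμ => ?_
  rw [smul_mul_assoc, Matrix.trace_smul,
    trace_Gam_mul_invChannel (Finset.mem_filter.1 hμ).2 (snapshot_mem_evenSubspace p b),
    trace_Gam_mul_snapshot, smul_eq_mul, mul_assoc]

theorem trace_sum_smul_Gam_mul_snapshot (g : Finset (Fin (2 * m)) → ℂ)
    (p : Equiv.Perm (Fin (2 * m))) (b : Bits m) :
    ((∑ τ : Finset (Fin (2 * m)), g τ • Gam τ) * snapshot p b).trace =
      ∑ τ, g τ * rotDiag p τ b := by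
  simp only [Finset.sum_mul, Matrix.trace_sum, smul_mul_assoc, Matrix.trace_smul,
    trace_Gam_mul_snapshot, smul_eq_mul]

/-! ### The second moment -/

-- The core of the second moment at fixed `p`: after the two factors merge, orthogonality leaves
-- only `τ = μ ∆ ν`. Without joint alignment one of the factors vanishes.
open Classical in
theorem sum_sum_rotDiag_mul (g : Finset (Fin (2 * m)) → ℂ) (p : Equiv.Perm (Fin (2 * m)))
    (μ ν : Finset (Fin (2 * m))) :
    ∑ b, (∑ τ, g τ * rotDiag p τ b) * (rotDiag p μ b * rotDiag p ν b) =
      if Aligned (vennColoring μ ν) p then 2 ^ m * prodCoeff g μ ν else 0 := by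
  split_ifs with h
  · simp only [rotDiag_mul_rotDiag h, Finset.sum_mul]
    rw [Finset.sum_comm]
    have : ∀ τ, ∑ b, g τ * rotDiag p τ b * (majSign μ ν * rotDiag p (symmDiff μ ν) b) =
        if symmDiff μ ν = τ then majSign μ ν * g τ * 2 ^ m else 0 := fun τ => by
      have h1 : ∀ b, g τ * rotDiag p τ b * (majSign μ ν * rotDiag p (symmDiff μ ν) b) =
          majSign μ ν * g τ * (rotDiag p (symmDiff μ ν) b * rotDiag p τ b) := fun b => by ring
      simp only [h1, ← Finset.mul_sum, sum_rotDiag_mul_rotDiag, h.symmDiff, and_true, mul_ite,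
        mul_zero]
    simp only [this, Finset.sum_ite_eq, Finset.mem_univ, if_true, prodCoeff]
    ring
  · refine Finset.sum_eq_zero fun b _ => ?_
    rw [aligned_vennColoring_iff, not_and_or] at h
    rcases h with h | h <;> simp [rotDiag_eq_zero h]

theorem expectation_estimator_sq (g h : Finset (Fin (2 * m)) → ℂ) :
    expectation (∑ τ : Finset (Fin (2 * m)), g τ • Gam τ) (fun p b =>
        estimator (∑ μ : Finset (Fin (2 * m)) with Even μ.card, h μ • Gam μ) p b ^ 2) =
      2 ^ m * ∑ μ : Finset (Fin (2 * m)) with Even μ.card,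
        ∑ μ' : Finset (Fin (2 * m)) with Even μ'.card ∧ Even (μ ∩ μ').card,
          (kap μ μ' : ℂ) * h μ * h μ' * prodCoeff g μ μ' := by
  classical
  have hfix : ∀ p : Equiv.Perm (Fin (2 * m)), ∑ b : Bits m, (∑ τ, g τ * rotDiag p τ b) *
      (∑ μ : Finset (Fin (2 * m)) with Even μ.card,
        h μ * (lam m μ.card : ℂ)⁻¹ * rotDiag p μ b) ^ 2 =
      ∑ μ : Finset (Fin (2 * m)) with Even μ.card, ∑ ν : Finset (Fin (2 * m)) with Even ν.card,
        h μ * (lam m μ.card : ℂ)⁻¹ * (h ν * (lam m ν.card : ℂ)⁻¹) *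
          if Aligned (vennColoring μ ν) p then 2 ^ m * prodCoeff g μ ν else 0 := by
    intro p
    simp only [← sum_sum_rotDiag_mul, Finset.mul_sum (s := (Finset.univ : Finset (Bits m)))]
    rw [Finset.sum_congr rfl fun μ _ => Finset.sum_comm, Finset.sum_comm]
    refine Finset.sum_congr rfl fun b _ => ?_
    rw [pow_two, Finset.sum_mul_sum, Finset.mul_sum]
    refine Finset.sum_congr rfl fun μ _ => ?_
    rw [Finset.mul_sum]
    exact Finset.sum_congr rfl fun ν _ => by ring
  simp only [expectation, trace_sum_smul_Gam_mul_snapshot, estimator_sum_smul_Gam, smul_eq_mul,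
    hfix]
  rw [Finset.sum_comm, Finset.mul_sum, Finset.mul_sum]
  refine Finset.sum_congr rfl fun μ _ => ?_
  rw [Finset.sum_comm, Finset.mul_sum, Finset.mul_sum]
  conv_rhs => rw [← Finset.filter_filter, Finset.sum_filter]
  refine Finset.sum_congr rfl fun ν _ => ?_
  -- Averaging over `p` turns the joint alignment indicator into `lamPair`; the two inverse
  -- eigenvalues complete it to `kap`.
  rw [← Finset.mul_sum, mul_left_comm, expectation_ite_aligned, card_aligned_vennColoring]
  split_ifs with hi
  · unfold kap
    push_cast
    ring
  -- Pairs with odd intersection are never jointly aligned, which is why the final sum omits them.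
  · rw [lamPair, if_neg fun h => hi h.2.2]
    simp

end MajoranaShadow

open MajoranaShadow ComplexOrder in
theorem mainTheorem2 (m : ℕ) :
    -- the channel is diagonal in the Majorana basis
    (∀ μ : Finset (Fin (2 * m)), channel (Gam μ) = (lam m μ.card : ℂ) • Gam μ) ∧
    -- it is invertible on the even subspace, which contains every measured state
    Set.BijOn (channel (m := m)) (evenSubspace m) (evenSubspace m) ∧
    (∀ (p : Equiv.Perm (Fin (2 * m))) (b : Bits m), snapshot p b ∈ evenSubspace m) ∧
    -- the sign in `g_{μ μ'}` is well defined
    (∀ μ μ' : Finset (Fin (2 * m)), Even μ.card → Even μ'.card → Even (μ ∩ μ').card →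
      Gam μ * Gam μ' = majSign μ μ' • Gam (symmDiff μ μ')) ∧
    -- the second moment of the estimator
    ∀ (ρ H : Op m) (g h : Finset (Fin (2 * m)) → ℂ),
      ρ.PosSemidef → ρ.trace = 1 → H.IsHermitian →
      ρ = ∑ τ : Finset (Fin (2 * m)), g τ • Gam τ →
      H = ∑ μ : Finset (Fin (2 * m)) with Even μ.card, h μ • Gam μ →
      expectation ρ (fun p b => estimator H p b ^ 2) =
        2 ^ m * ∑ μ : Finset (Fin (2 * m)) with Even μ.card,
          ∑ μ' : Finset (Fin (2 * m)) with Even μ'.card ∧ Even (μ ∩ μ').card,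
            (kap μ μ' : ℂ) * h μ * h μ' * prodCoeff g μ μ' := by
  refine ⟨channel_Gam, channel_bijOn, snapshot_mem_evenSubspace,
    fun μ μ' hμ hμ' h => Gam_mul_Gam_eq_majSign hμ hμ' h, ?_⟩
  rintro ρ H g h - - - rfl rfl
  exact expectation_estimator_sq g h
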